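/- Let $l\neq 0$ be a real number, let $W\subset\{(u,x,y)\in\mathbb R^3 : x\neq 0\}$ be open (for instance $W=\{x\ne 0\}$ or $W=\{x>0\}$), and let $H\colon W\to\mathbb R$ be an arbitrary smooth function. On the open set $M=\{(\eta,u,v,x,y)\in\mathbb R^5 : (u,x,y)\in W\}$, with coordinates numbered $1,\dots,5$ in the order $\eta,u,v,x,y$, consider $$ds^2=d\eta^2+\frac{l^2}{x^2}\left(H(u,x,y)\,du^2+2\,du\,dv+dx^2+dy^2\right).$$ Conventions: with the Christoffel symbols $\Gamma^a_{bc}$ of the Levi-Civita connection, $$R_{abcd}=g_{a\alpha}\left(\partial_d\Gamma^\alpha_{bc}-\partial_c\Gamma^\alpha_{bd}+\Gamma^\beta_{bc}\Gamma^\alpha_{\beta d}-\Gamma^\beta_{bd}\Gamma^\alpha_{\beta c}\right),\quad S_{ab}=g^{\alpha\beta}R_{\alpha ab\beta},\quad \kappa=g^{ab}S_{ab},$$ $$(E\wedge D)_{abcd}=E_{ad}D_{bc}+E_{bc}D_{ad}-E_{ac}D_{bd}-E_{bd}D_{ac},$$ the Weyl conformal curvature tensor (here $n=5$) is $$C=R+\frac{\kappa}{2(n-1)(n-2)}\,g\wedge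 g-\frac1{n-2}\,g\wedge S,$$ and for $(0,4)$-tensors $L,U$ $$(L\cdot U)_{ijklab}=-g^{\alpha\beta}\left(L_{abi\alpha}U_{\beta jkl}+L_{abj\alpha}U_{i\beta kl}+L_{abk\alpha}U_{ij\beta l}+L_{abl\alpha}U_{ijk\beta}\right).$$ Then $ds^2$ is a semi-Riemannian metric on $M$ (smooth, symmetric, nondegenerate), and at every point of $M$: (i) $C\cdot C=0$; (ii) the tensor $B=C\cdot R$ satisfies $$B_{122312}=B_{142412}=B_{152512}=\frac{-2H_x+x\,(H_{xx}+H_{yy})}{6x^3},$$ it has the symmetries $B_{bacdef}=-B_{abcdef}$, $B_{abdcef}=-B_{abcdef}$, $B_{cdabef}=B_{abcdef}$, $B_{abcdfe}=-B_{abcdef}$, and every component of $B$ that is not obtained from one of these three by these symmetries vanishes; (iii) $C\cdot R\neq 0$ at the point if and only if $-2H_x+x(H_{xx}+H_{yy})\neq 0$ there. In particular, $M$ satisfies $C\cdot C=0$ but not $C\cdot R=0$ whenever $-2H_x+x(H_{xx}+H_{yy})$ is not identically zero on $M$. -/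

import Mathlib

open scoped ContDiff

noncomputable section

namespace CoordGeometry

/-- A tensor of type `(0,4)` at a point, through its components in a coordinate frame. -/
abbrev Tensor4 (n : ℕ) := Fin n → Fin n → Fin n → Fin n → ℝ

/-- A tensor of type `(0,6)` at a point, through its components in a coordinate frame. -/
abbrev Tensor6 (n : ℕ) := Fin n → Fin n → Fin n → Fin n → Fin n → Fin n → ℝ

/-- The partial derivative `∂f/∂xᵃ` of a real function of `n` real variables. -/
def pd {n : ℕ} (a : Fin n) (f : (Fin n → ℝ) → ℝ) (p : Fin n → ℝ) : ℝ :=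
  fderiv ℝ f p (Pi.single a 1)

/-- The matrix field `g` is a semi-Riemannian metric on `U`: its components are smooth, and it is
symmetric and nondegenerate at each point. -/
structure IsMetricOn {n : ℕ} (g : (Fin n → ℝ) → Matrix (Fin n) (Fin n) ℝ)
    (U : Set (Fin n → ℝ)) : Prop where
  smooth : ∀ a b, ContDiffOn ℝ ∞ (fun p => g p a b) U
  symm : ∀ p ∈ U, (g p).IsSymm
  nondegenerate : ∀ p ∈ U, (g p).det ≠ 0

section

variable {n : ℕ} (g : (Fin n → ℝ) → Matrix (Fin n) (Fin n) ℝ)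

/-- The Christoffel symbols of the second kind `Γᵃ_{bc}` of the Levi-Civita connection. -/
def christoffel (a b c : Fin n) (p : Fin n → ℝ) : ℝ :=
  (1 / 2) * ∑ d, (g p)⁻¹ a d *
    (pd b (fun q => g q d c) p + pd c (fun q => g q d b) p - pd d (fun q => g q b c) p)

/-- The Riemann curvature tensor of type `(0,4)`:
`R_{abcd} = g_{aα} (∂_d Γᵅ_{bc} - ∂_c Γᵅ_{bd} + Γᵝ_{bc} Γᵅ_{βd} - Γᵝ_{bd} Γᵅ_{βc})`. -/
def riemann (p : Fin n → ℝ) : Tensor4 n := fun a b c d =>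
  ∑ α, g p a α *
    (pd d (christoffel g α b c) p - pd c (christoffel g α b d) p
      + ∑ β, (christoffel g β b c p * christoffel g α β d p
        - christoffel g β b d p * christoffel g α β c p))

/-- The Ricci tensor `S_{ab} = g^{αβ} R_{αabβ}`. -/
def ricci (p : Fin n → ℝ) : Matrix (Fin n) (Fin n) ℝ := fun a b =>
  ∑ α, ∑ β, (g p)⁻¹ α β * riemann g p α a b β

/-- The scalar curvature `κ = g^{ab} S_{ab}`. -/
def scalarCurvature (p : Fin n → ℝ) : ℝ :=
  ∑ a, ∑ b, (g p)⁻¹ a b * ricci g p a b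

/-- The Kulkarni-Nomizu product
`(E ∧ D)_{abcd} = E_{ad} D_{bc} + E_{bc} D_{ad} - E_{ac} D_{bd} - E_{bd} D_{ac}`. -/
def kulkarniNomizu (E D : Matrix (Fin n) (Fin n) ℝ) : Tensor4 n := fun a b c d =>
  E a d * D b c + E b c * D a d - E a c * D b d - E b d * D a c

/-- The Weyl conformal curvature tensor
`C = R + κ / (2 (n - 1) (n - 2)) g ∧ g - 1 / (n - 2) g ∧ S` (meaningful for `n ≥ 3`). -/
def weyl (p : Fin n → ℝ) : Tensor4 n := fun a b c d =>
  riemann g p a b c d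
    + scalarCurvature g p / (2 * ((n : ℝ) - 1) * ((n : ℝ) - 2))
      * kulkarniNomizu (g p) (g p) a b c d
    - 1 / ((n : ℝ) - 2) * kulkarniNomizu (g p) (ricci g p) a b c d

/-- The tensor `L · U` for `(0,4)` tensors `L` and `U` at `p`:
`(L · U)_{ijklab} = -g^{αβ} (L_{abiα} U_{βjkl} + L_{abjα} U_{iβkl} + L_{abkα} U_{ijβl}
+ L_{ablα} U_{ijkβ})`. -/
def dot (p : Fin n → ℝ) (L U : Tensor4 n) : Tensor6 n := fun i j k l a b =>
  -∑ α, ∑ β, (g p)⁻¹ α β *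
    (L a b i α * U β j k l + L a b j α * U i β k l
      + L a b k α * U i j β l + L a b l α * U i j k β)

end

/-- In coordinates `p = (η, u, v, x, y)` of `ℝ⁵`, the triple `(u, x, y)`. -/
def uxy (p : Fin 5 → ℝ) : Fin 3 → ℝ := ![p 1, p 3, p 4]

/-- The matrix of the metric `dη² + (l²/x²) (H(u,x,y) du² + 2 du dv + dx² + dy²)`
in the coordinates `(η, u, v, x, y)`. -/
def siklosMetric (l : ℝ) (H : (Fin 3 → ℝ) → ℝ) (p : Fin 5 → ℝ) : Matrix (Fin 5) (Fin 5) ℝ :=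
  !![1, 0, 0, 0, 0;
     0, l ^ 2 / p 3 ^ 2 * H (uxy p), l ^ 2 / p 3 ^ 2, 0, 0;
     0, l ^ 2 / p 3 ^ 2, 0, 0, 0;
     0, 0, 0, l ^ 2 / p 3 ^ 2, 0;
     0, 0, 0, 0, l ^ 2 / p 3 ^ 2]

/-- The function `-2 H_x + x (H_xx + H_yy)` of `q = (u, x, y)`. -/
def siklosPhi (H : (Fin 3 → ℝ) → ℝ) (q : Fin 3 → ℝ) : ℝ :=
  -2 * pd 1 H q + q 1 * (pd 1 (pd 1 H) q + pd 2 (pd 2 H) q)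

end CoordGeometry

end

/-! Write `s = l²/x²`, `t = 1/s`, `r = 1/x` and `h = H du² + 2 du dv + dx² + dy²`, so that the
metric is `dη² + s h`. A direct computation gives `R = -(s r²/2) h ∧ h + du² ∧ A` with `A` quadratic
in `dx`, `dy`. The conformally flat part drops out of the Weyl tensor, which leaves `C = du² ∧ Q`
with `Q` quadratic in `dη`, `dx`, `dy`. With two indices frozen, `C` is a null rotation `du ∧ (a dη
+ b dx + c dy)`. As a derivation it kills `du²` and sends `Q` and `A` to symmetric products `du ω`;
since `du² ∧ (du ω) = 0`, it annihilates `du² ∧ Q` and `du² ∧ A`. Hence `C · C = 0`, and `C · R`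
comes from `h ∧ h` alone. There `h` goes to a multiple of `dη du`, with the coefficient of `dη²` in
`Q` as factor. That coefficient is `φ/(6x)`, `φ` being `siklosPhi`, and `r²` turns it into
`φ/(6x³)`. The lemmas `nullRotation_sum_nullSq` and `nullRotation_sum_siklosCurvature` carry this.
-/

noncomputable section

namespace CoordGeometry

/-! ### The metric and its inverse in terms of coordinate covectors -/

/-- The components of the coordinate covector `dxⁱ` of `ℝ⁵`. -/
def dX (i a : Fin 5) : ℝ := if a = i then 1 else 0

@[simp] theorem dX_self (i : Fin 5) : dX i i = 1 := if_pos rfl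

theorem dX_of_ne {i a : Fin 5} (h : a ≠ i) : dX i a = 0 := if_neg h

@[simp] theorem dX01 : dX 0 1 = 0 := dX_of_ne (by decide)
@[simp] theorem dX02 : dX 0 2 = 0 := dX_of_ne (by decide)
@[simp] theorem dX03 : dX 0 3 = 0 := dX_of_ne (by decide)
@[simp] theorem dX04 : dX 0 4 = 0 := dX_of_ne (by decide)
@[simp] theorem dX10 : dX 1 0 = 0 := dX_of_ne (by decide)
@[simp] theorem dX12 : dX 1 2 = 0 := dX_of_ne (by decide)
@[simp] theorem dX13 : dX 1 3 = 0 := dX_of_ne (by decide)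
@[simp] theorem dX14 : dX 1 4 = 0 := dX_of_ne (by decide)
@[simp] theorem dX20 : dX 2 0 = 0 := dX_of_ne (by decide)
@[simp] theorem dX21 : dX 2 1 = 0 := dX_of_ne (by decide)
@[simp] theorem dX23 : dX 2 3 = 0 := dX_of_ne (by decide)
@[simp] theorem dX24 : dX 2 4 = 0 := dX_of_ne (by decide)
@[simp] theorem dX30 : dX 3 0 = 0 := dX_of_ne (by decide)
@[simp] theorem dX31 : dX 3 1 = 0 := dX_of_ne (by decide)
@[simp] theorem dX32 : dX 3 2 = 0 := dX_of_ne (by decide)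
@[simp] theorem dX34 : dX 3 4 = 0 := dX_of_ne (by decide)
@[simp] theorem dX40 : dX 4 0 = 0 := dX_of_ne (by decide)
@[simp] theorem dX41 : dX 4 1 = 0 := dX_of_ne (by decide)
@[simp] theorem dX42 : dX 4 2 = 0 := dX_of_ne (by decide)
@[simp] theorem dX43 : dX 4 3 = 0 := dX_of_ne (by decide)

/-- The plane-wave metric `H du² + 2 du dv + dx² + dy²`. -/
def waveMetric (H : ℝ) : Matrix (Fin 5) (Fin 5) ℝ := fun a b =>
  H * (dX 1 a * dX 1 b) + (dX 1 a * dX 2 b + dX 2 a * dX 1 b) + dX 3 a * dX 3 b + dX 4 a * dX 4 b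

/-- The metric `dη² + s (H du² + 2 du dv + dx² + dy²)`. -/
def prodMetric (s H : ℝ) : Matrix (Fin 5) (Fin 5) ℝ := fun a b =>
  dX 0 a * dX 0 b + s * waveMetric H a b

/-- The inverse of `prodMetric s H`, where `t = s⁻¹`. -/
def prodMetricInv (t H : ℝ) : Matrix (Fin 5) (Fin 5) ℝ := fun a b =>
  dX 0 a * dX 0 b + t * ((dX 1 a * dX 2 b + dX 2 a * dX 1 b) - H * (dX 2 a * dX 2 b)
    + dX 3 a * dX 3 b + dX 4 a * dX 4 b)

theorem siklosMetric_eq (l : ℝ) (H : (Fin 3 → ℝ) → ℝ) (p : Fin 5 → ℝ) :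
    siklosMetric l H p = prodMetric (l ^ 2 / p 3 ^ 2) (H (uxy p)) := by
  ext a b
  fin_cases a <;> fin_cases b <;> simp [siklosMetric, prodMetric, waveMetric]

theorem prodMetric_mul_inv {s t : ℝ} (hst : s * t = 1) (H : ℝ) :
    prodMetric s H * prodMetricInv t H = 1 := by
  ext a b
  -- Writing the identity matrix with the factor `s * t` makes the claim a polynomial identity in
  -- independent `s` and `t`.
  have h1 : (1 : Matrix (Fin 5) (Fin 5) ℝ) a b = dX 0 a * dX 0 b + (s * t) * (dX 1 a * dX 1 b
      + dX 2 a * dX 2 b + dX 3 a * dX 3 b + dX 4 a * dX 4 b) := by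
    rw [hst]; fin_cases a <;> fin_cases b <;> simp
  rw [h1, Matrix.mul_apply]
  simp [Fin.sum_univ_five, prodMetric, prodMetricInv, waveMetric]
  ring

theorem prodMetric_inv {s t : ℝ} (hst : s * t = 1) (H : ℝ) :
    (prodMetric s H)⁻¹ = prodMetricInv t H :=
  Matrix.inv_eq_right_inv (prodMetric_mul_inv hst H)

/-! ### Connection, curvature and Weyl tensor as pointwise algebra -/

/-- The Christoffel symbols of `dη² + (l²/x²) (H du² + 2 du dv + dx² + dy²)`, where `r = 1/x`. -/
def siklosChristoffel (r H Hu Hx Hy : ℝ) (a b c : Fin 5) : ℝ :=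
  (-(dX 1 a * dX 1 b + dX 2 a * dX 2 b + dX 3 a * dX 3 b + dX 4 a * dX 4 b) * dX 3 c
    - (dX 1 a * dX 1 c + dX 2 a * dX 2 c + dX 3 a * dX 3 c + dX 4 a * dX 4 c) * dX 3 b
    + waveMetric 0 b c * dX 3 a) * r
  + (dX 1 b * dX 1 c * dX 3 a) * (r * H)
  + (dX 2 a * dX 1 b * dX 1 c / 2) * Hu
  + ((dX 2 a * (dX 1 b * dX 3 c + dX 3 b * dX 1 c) - dX 3 a * dX 1 b * dX 1 c) / 2) * Hx
  + ((dX 2 a * (dX 1 b * dX 4 c + dX 4 b * dX 1 c) - dX 4 a * dX 1 b * dX 1 c) / 2) * Hy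

/-- The components of the differential `fu du + fx dx + fy dy`. -/
def diffUXY (fu fx fy : ℝ) (d : Fin 5) : ℝ := fu * dX 1 d + fx * dX 3 d + fy * dX 4 d

/-- The partial derivatives of `dη² + (l²/x²) (H du² + 2 du dv + dx² + dy²)`, with `r = 1/x` and
`s = l²/x²`. -/
def prodMetricDeriv (r s H Hu Hx Hy : ℝ) (d a b : Fin 5) : ℝ :=
  s * (-2 * r * dX 3 d * waveMetric H a b + diffUXY Hu Hx Hy d * (dX 1 a * dX 1 b))

theorem sum_prodMetricDeriv {s t : ℝ} (hst : s * t = 1) (r H Hu Hx Hy : ℝ) (a b c : Fin 5) :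
    (1 / 2) * ∑ d, prodMetricInv t H a d * (prodMetricDeriv r s H Hu Hx Hy b d c
      + prodMetricDeriv r s H Hu Hx Hy c d b - prodMetricDeriv r s H Hu Hx Hy d b c)
      = siklosChristoffel r H Hu Hx Hy a b c := by
  rw [show siklosChristoffel r H Hu Hx Hy a b c = s * t * siklosChristoffel r H Hu Hx Hy a b c by
    rw [hst, one_mul]]
  simp [Fin.sum_univ_five, prodMetricInv, prodMetricDeriv, waveMetric, siklosChristoffel, diffUXY]
  ring

/-- The derivative of `siklosChristoffel` in direction `d`. -/
def siklosChristoffelDeriv (r H Hu Hx Hy Huu Hux Huy Hxx Hxy Hyy : ℝ) (a b c d : Fin 5) : ℝ :=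
  (-(dX 1 a * dX 1 b + dX 2 a * dX 2 b + dX 3 a * dX 3 b + dX 4 a * dX 4 b) * dX 3 c
    - (dX 1 a * dX 1 c + dX 2 a * dX 2 c + dX 3 a * dX 3 c + dX 4 a * dX 4 c) * dX 3 b
    + waveMetric 0 b c * dX 3 a) * (-r ^ 2 * dX 3 d)
  + (dX 1 b * dX 1 c * dX 3 a) * (r * diffUXY Hu Hx Hy d + H * (-r ^ 2 * dX 3 d))
  + (dX 2 a * dX 1 b * dX 1 c / 2) * diffUXY Huu Hux Huy d
  + ((dX 2 a * (dX 1 b * dX 3 c + dX 3 b * dX 1 c) - dX 3 a * dX 1 b * dX 1 c) / 2)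
    * diffUXY Hux Hxx Hxy d
  + ((dX 2 a * (dX 1 b * dX 4 c + dX 4 b * dX 1 c) - dX 4 a * dX 1 b * dX 1 c) / 2)
    * diffUXY Huy Hxy Hyy d

/-- The symmetric matrix `α dη² + β dx² + 2 γ dx dy + δ dy²`. -/
def transverse (α β γ δ : ℝ) : Matrix (Fin 5) (Fin 5) ℝ := fun a b =>
  α * (dX 0 a * dX 0 b) + β * (dX 3 a * dX 3 b) + γ * (dX 3 a * dX 4 b + dX 4 a * dX 3 b)
    + δ * (dX 4 a * dX 4 b)

/-- The square `du²` of the null covector `du`. -/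
def nullSq : Matrix (Fin 5) (Fin 5) ℝ := fun a b => dX 1 a * dX 1 b

/-- The tensor `-(s r²/2) h ∧ h + du² ∧ A` with `h = H du² + 2 du dv + dx² + dy²` and
`A = β dx² + 2 γ dx dy + δ dy²`. -/
def siklosCurvature (r s H β γ δ : ℝ) : Tensor4 5 := fun a b c d =>
  -(s * r ^ 2 / 2) * kulkarniNomizu (waveMetric H) (waveMetric H) a b c d
    + kulkarniNomizu nullSq (transverse 0 β γ δ) a b c d

/-- The derivatives of `H` are treated as independent real numbers, which separates the curvature
algebra from the calculus. All derivatives in `u` cancel. -/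
theorem sum_siklosChristoffelDeriv (r s H Hu Hx Hy Huu Hux Huy Hxx Hxy Hyy : ℝ)
    (a b c d : Fin 5) :
    ∑ α, prodMetric s H a α *
      (siklosChristoffelDeriv r H Hu Hx Hy Huu Hux Huy Hxx Hxy Hyy α b c d
        - siklosChristoffelDeriv r H Hu Hx Hy Huu Hux Huy Hxx Hxy Hyy α b d c
        + ∑ β, (siklosChristoffel r H Hu Hx Hy β b c * siklosChristoffel r H Hu Hx Hy α β d
          - siklosChristoffel r H Hu Hx Hy β b d * siklosChristoffel r H Hu Hx Hy α β c))
      = siklosCurvature r s H (-(s / 2) * (Hxx - r * Hx)) (-(s / 2) * Hxy)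
          (-(s / 2) * (Hyy - r * Hx)) a b c d := by
  simp [Fin.sum_univ_five, prodMetric, waveMetric, siklosChristoffel, siklosChristoffelDeriv,
    siklosCurvature, kulkarniNomizu, transverse, nullSq, diffUXY]
  ring

theorem ricci_siklosCurvature {s t : ℝ} (hst : s * t = 1) (r H β γ δ : ℝ) (a b : Fin 5) :
    ∑ i, ∑ j, prodMetricInv t H i j * siklosCurvature r s H β γ δ i a b j
      = -3 * r ^ 2 * waveMetric H a b + t * (β + δ) * nullSq a b := by
  rw [show -3 * r ^ 2 * waveMetric H a b = s * t * (-3 * r ^ 2 * waveMetric H a b) by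
    rw [hst, one_mul]]
  simp [Fin.sum_univ_five, prodMetricInv, siklosCurvature, kulkarniNomizu, waveMetric, transverse,
    nullSq]
  ring

/-- `du` is null, so `ρ` does not contribute; the trace of `h` is `4 t`. -/
theorem scalar_siklosCurvature (t r H ρ : ℝ) :
    ∑ i, ∑ j, prodMetricInv t H i j * (-3 * r ^ 2 * waveMetric H i j + ρ * nullSq i j)
      = -12 * r ^ 2 * t := by
  simp [Fin.sum_univ_five, prodMetricInv, waveMetric, nullSq]
  ring

/-- The Weyl tensor of `dη² + (l²/x²) (H du² + 2 du dv + dx² + dy²)` is of the form `du² ∧ Q` with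
`Q` a symmetric matrix in `dη`, `dx`, `dy`. -/
theorem weyl_siklosCurvature {s t : ℝ} (hst : s * t = 1) (r H β γ δ : ℝ) (a b c d : Fin 5) :
    siklosCurvature r s H β γ δ a b c d
      + -12 * r ^ 2 * t / 24 * kulkarniNomizu (prodMetric s H) (prodMetric s H) a b c d
      - 1 / 3 * kulkarniNomizu (prodMetric s H)
          (fun a b => -3 * r ^ 2 * waveMetric H a b + t * (β + δ) * nullSq a b) a b c d
      = kulkarniNomizu nullSq (transverse (-(t * (β + δ)) / 3) ((2 * β - δ) / 3) γ
          ((2 * δ - β) / 3)) a b c d := by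
  -- For arbitrary `h`, the terms in `h ∧ h` and `dη² ∧ h` cancel, using `s t = 1` and `dη² ∧ dη² =
  -- 0`. The special form of `h` enters only afterwards: `du² ∧ h = du² ∧ (dx² + dy²)`.
  have key : ∀ (h : Matrix (Fin 5) (Fin 5) ℝ),
      -(s * r ^ 2 / 2) * kulkarniNomizu h h a b c d
        + -12 * r ^ 2 * t / 24 * kulkarniNomizu (fun a b => dX 0 a * dX 0 b + s * h a b)
            (fun a b => dX 0 a * dX 0 b + s * h a b) a b c d
        - 1 / 3 * kulkarniNomizu (fun a b => dX 0 a * dX 0 b + s * h a b)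
            (fun a b => -3 * r ^ 2 * h a b + t * (β + δ) * nullSq a b) a b c d
      = -(β + δ) / 3 * kulkarniNomizu nullSq (fun a b => t * (dX 0 a * dX 0 b) + h a b)
          a b c d := by
    intro h
    linear_combination (norm := skip) (-(s * r ^ 2 / 2) * kulkarniNomizu h h a b c d
      - r ^ 2 * kulkarniNomizu (fun a b => dX 0 a * dX 0 b) h a b c d
      - (β + δ) / 3 * kulkarniNomizu nullSq h a b c d) * hst
    simp only [kulkarniNomizu]
    ring
  have h := key (waveMetric H)
  change _ + -12 * r ^ 2 * t / 24 * kulkarniNomizu (prodMetric s H) (prodMetric s H) a b c d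
    - 1 / 3 * kulkarniNomizu (prodMetric s H) _ a b c d = _ at h
  rw [siklosCurvature, add_right_comm, add_sub_right_comm, h]
  simp only [kulkarniNomizu, nullSq, transverse, waveMetric]
  ring

/-! ### Null rotations acting as derivations -/

/-- The action on a symmetric bilinear form of an endomorphism with lowered components `L`, where
`G` is the inverse metric. -/
def formAction {n : ℕ} (G L E : Matrix (Fin n) (Fin n) ℝ) : Matrix (Fin n) (Fin n) ℝ := fun i j =>
  -∑ α, ∑ β, G α β * (L i α * E β j + L j α * E i β)

/-- The derivation rule for the Kulkarni-Nomizu product. -/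
theorem sum_kulkarniNomizu {n : ℕ} (G L E D : Matrix (Fin n) (Fin n) ℝ) (i j k l : Fin n) :
    -∑ α, ∑ β, G α β * (L i α * kulkarniNomizu E D β j k l + L j α * kulkarniNomizu E D i β k l
        + L k α * kulkarniNomizu E D i j β l + L l α * kulkarniNomizu E D i j k β)
      = kulkarniNomizu (formAction G L E) D i j k l
        + kulkarniNomizu E (formAction G L D) i j k l := by
  simp only [kulkarniNomizu, formAction, ← Finset.sum_neg_distrib, Finset.sum_mul, Finset.mul_sum,
    ← Finset.sum_add_distrib, ← Finset.sum_sub_distrib]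
  refine Finset.sum_congr rfl fun α _ => Finset.sum_congr rfl fun β _ => ?_
  ring

/-- The null rotation `du ∧ (a dη + b dx + c dy)`. -/
def nullRotation (a b c : ℝ) : Matrix (Fin 5) (Fin 5) ℝ := fun i j =>
  dX 1 i * (a * dX 0 j + b * dX 3 j + c * dX 4 j)
    - dX 1 j * (a * dX 0 i + b * dX 3 i + c * dX 4 i)

theorem kulkarniNomizu_nullSq_eq_nullRotation (α β γ δ : ℝ) (a b i j : Fin 5) :
    kulkarniNomizu nullSq (transverse α β γ δ) a b i j
      = nullRotation (α * (dX 0 a * dX 1 b - dX 1 a * dX 0 b))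
          (β * (dX 3 a * dX 1 b - dX 1 a * dX 3 b) + γ * (dX 4 a * dX 1 b - dX 1 a * dX 4 b))
          (γ * (dX 3 a * dX 1 b - dX 1 a * dX 3 b) + δ * (dX 4 a * dX 1 b - dX 1 a * dX 4 b))
          i j := by
  simp only [kulkarniNomizu, nullSq, transverse, nullRotation]
  ring

/-- The symmetric matrix `2 dη du`. -/
def crossSq : Matrix (Fin 5) (Fin 5) ℝ := fun a b => dX 0 a * dX 1 b + dX 1 a * dX 0 b

/-- For `t ≠ 0` a null rotation is skew for the metric, hence kills `dη² + s h`; its effect on `h`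
is `-t` times its effect on `dη²`, which sees only `a`. -/
theorem formAction_waveMetric (t H a b c : ℝ) :
    formAction (prodMetricInv t H) (nullRotation a b c) (waveMetric H)
      = fun i j => t * a * crossSq i j := by
  ext i j
  simp [formAction, Fin.sum_univ_five, prodMetricInv, nullRotation, waveMetric, crossSq]
  ring

theorem formAction_nullSq (t H a b c : ℝ) :
    formAction (prodMetricInv t H) (nullRotation a b c) nullSq = 0 := by
  ext i j
  simp [formAction, Fin.sum_univ_five, prodMetricInv, nullRotation, nullSq]

theorem kulkarniNomizu_nullSq_formAction (t H a b c α β γ δ : ℝ) (i j k l : Fin 5) :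
    kulkarniNomizu nullSq
      (formAction (prodMetricInv t H) (nullRotation a b c) (transverse α β γ δ)) i j k l = 0 := by
  have h : formAction (prodMetricInv t H) (nullRotation a b c) (transverse α β γ δ)
      = fun i j => -(dX 1 i * (α * a * dX 0 j + t * (β * b + γ * c) * dX 3 j
            + t * (γ * b + δ * c) * dX 4 j)
          + dX 1 j * (α * a * dX 0 i + t * (β * b + γ * c) * dX 3 i
            + t * (γ * b + δ * c) * dX 4 i)) := by
    ext i j
    simp [formAction, Fin.sum_univ_five, prodMetricInv, nullRotation, transverse]
    ring
  rw [h]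
  simp only [kulkarniNomizu, nullSq]
  ring

theorem kulkarniNomizu_zero_left {n : ℕ} (D : Matrix (Fin n) (Fin n) ℝ) (i j k l : Fin n) :
    kulkarniNomizu 0 D i j k l = 0 := by
  simp [kulkarniNomizu]

/-- Used twice: with `Q` it gives `C · C = 0`, and with `α = 0` it removes `du² ∧ A` from `C · R`.
-/
theorem nullRotation_sum_nullSq (t H a b c α β γ δ : ℝ) (i j k l : Fin 5) :
    -∑ x, ∑ y, prodMetricInv t H x y *
      (nullRotation a b c i x * kulkarniNomizu nullSq (transverse α β γ δ) y j k l
        + nullRotation a b c j x * kulkarniNomizu nullSq (transverse α β γ δ) i y k l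
        + nullRotation a b c k x * kulkarniNomizu nullSq (transverse α β γ δ) i j y l
        + nullRotation a b c l x * kulkarniNomizu nullSq (transverse α β γ δ) i j k y) = 0 := by
  rw [sum_kulkarniNomizu, formAction_nullSq, kulkarniNomizu_zero_left,
    kulkarniNomizu_nullSq_formAction, add_zero]

/-- The two equal factors give the `2`. `H` disappears on the right because `du² ∧ (dη du) = 0`. -/
theorem nullRotation_sum_waveMetric (t H a b c : ℝ) (i j k l : Fin 5) :
    -∑ x, ∑ y, prodMetricInv t H x y *
      (nullRotation a b c i x * kulkarniNomizu (waveMetric H) (waveMetric H) y j k l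
        + nullRotation a b c j x * kulkarniNomizu (waveMetric H) (waveMetric H) i y k l
        + nullRotation a b c k x * kulkarniNomizu (waveMetric H) (waveMetric H) i j y l
        + nullRotation a b c l x * kulkarniNomizu (waveMetric H) (waveMetric H) i j k y)
      = 2 * t * a * kulkarniNomizu (waveMetric 0) crossSq i j k l := by
  rw [sum_kulkarniNomizu, formAction_waveMetric]
  simp only [kulkarniNomizu, waveMetric, crossSq]
  ring

theorem nullRotation_sum_siklosCurvature (t r s H a b c β γ δ : ℝ) (i j k l : Fin 5) :
    -∑ x, ∑ y, prodMetricInv t H x y *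
      (nullRotation a b c i x * siklosCurvature r s H β γ δ y j k l
        + nullRotation a b c j x * siklosCurvature r s H β γ δ i y k l
        + nullRotation a b c k x * siklosCurvature r s H β γ δ i j y l
        + nullRotation a b c l x * siklosCurvature r s H β γ δ i j k y)
      = -(s * t) * r ^ 2 * a * kulkarniNomizu (waveMetric 0) crossSq i j k l := by
  have h1 := nullRotation_sum_waveMetric t H a b c i j k l
  have h2 := nullRotation_sum_nullSq t H a b c 0 β γ δ i j k l
  have h3 : -(s * t) * r ^ 2 * a * kulkarniNomizu (waveMetric 0) crossSq i j k l
    = -(s * r ^ 2 / 2) * (2 * t * a * kulkarniNomizu (waveMetric 0) crossSq i j k l) + 0 := by ring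
  rw [h3, ← h1, ← h2]
  simp only [siklosCurvature, ← Finset.sum_neg_distrib, Finset.mul_sum, ← Finset.sum_add_distrib]
  refine Finset.sum_congr rfl fun x _ => Finset.sum_congr rfl fun y _ => ?_
  ring

/-- Unordered pairs of unordered pairs encode index quadruples up to the symmetries of a curvature
tensor. -/
theorem kulkarniNomizu_waveMetric_crossSq_support (a b c d : Fin 5)
    (h : kulkarniNomizu (waveMetric 0) crossSq a b c d ≠ 0) :
    s(s(a, b), s(c, d)) = s(s(0, 1), s(1, 2)) ∨ s(s(a, b), s(c, d)) = s(s(0, 3), s(1, 3)) ∨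
      s(s(a, b), s(c, d)) = s(s(0, 4), s(1, 4)) := by
  -- Integer copies of the tensors make the finite check over all indices decidable by computation.
  let e : Fin 5 → Fin 5 → ℤ := fun i a => if a = i then 1 else 0
  let w : Fin 5 → Fin 5 → ℤ := fun a b =>
    e 1 a * e 2 b + e 2 a * e 1 b + e 3 a * e 3 b + e 4 a * e 4 b
  let z : Fin 5 → Fin 5 → ℤ := fun a b => e 0 a * e 1 b + e 1 a * e 0 b
  have he : ∀ i a, dX i a = (e i a : ℝ) := fun i a => by simp [dX, e]
  have key : ∀ a b c d : Fin 5,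
      w a d * z b c + w b c * z a d - w a c * z b d - w b d * z a c ≠ 0 →
      s(s(a, b), s(c, d)) = s(s(0, 1), s(1, 2)) ∨ s(s(a, b), s(c, d)) = s(s(0, 3), s(1, 3)) ∨
      s(s(a, b), s(c, d)) = s(s(0, 4), s(1, 4)) := by
    decide +kernel
  refine key a b c d fun h0 => h ?_
  have h1 : ((w a d * z b c + w b c * z a d - w a c * z b d - w b d * z a c : ℤ) : ℝ) = 0 := by
    rw [h0, Int.cast_zero]
  rw [← h1]
  simp only [kulkarniNomizu, waveMetric, crossSq, w, z, he]
  push_cast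
  ring

/-! ### Partial derivatives of the metric and the Christoffel symbols -/

theorem fderiv_apply_eq_sum_pd {n : ℕ} (f : (Fin n → ℝ) → ℝ) (p v : Fin n → ℝ) :
    fderiv ℝ f p v = ∑ i, v i * pd i f p := by
  conv_lhs => rw [pi_eq_sum_univ' v, map_sum]
  refine Finset.sum_congr rfl fun i _ => ?_
  rw [map_smul, smul_eq_mul, pd]

theorem pd_congr {n : ℕ} {f f' : (Fin n → ℝ) → ℝ} {U : Set (Fin n → ℝ)} (hU : IsOpen U)
    (h : ∀ q ∈ U, f q = f' q) {p : Fin n → ℝ} (hp : p ∈ U) (a : Fin n) : pd a f p = pd a f' p := by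
  rw [pd, pd, Filter.EventuallyEq.fderiv_eq (Filter.eventually_of_mem (hU.mem_nhds hp) h)]

theorem contDiffOn_pd {n : ℕ} {f : (Fin n → ℝ) → ℝ} {U : Set (Fin n → ℝ)} (hU : IsOpen U)
    (hf : ContDiffOn ℝ ∞ f U) (a : Fin n) : ContDiffOn ℝ ∞ (pd a f) U :=
  (hf.fderiv_of_isOpen hU (m := ∞) (by simp)).clm_apply contDiffOn_const

theorem pd_comm {n : ℕ} {f : (Fin n → ℝ) → ℝ} {U : Set (Fin n → ℝ)} (hU : IsOpen U)
    (hf : ContDiffOn ℝ ∞ f U) {p : Fin n → ℝ} (hp : p ∈ U) (a b : Fin n) :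
    pd a (pd b f) p = pd b (pd a f) p := by
  have hd : DifferentiableAt ℝ (fderiv ℝ f) p :=
    ((hf.fderiv_of_isOpen hU (m := ∞) (by simp)).contDiffAt (hU.mem_nhds hp)).differentiableAt
      (by simp)
  have h2 : ∀ i j : Fin n, pd i (pd j f) p
      = fderiv ℝ (fderiv ℝ f) p (Pi.single i 1) (Pi.single j 1) := fun i j => by
    have := (hd.hasFDerivAt.clm_apply (hasFDerivAt_const (Pi.single j (1 : ℝ)) p)).fderiv
    change fderiv ℝ (fun q => fderiv ℝ f q (Pi.single j 1)) p (Pi.single i 1) = _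
    rw [this]
    simp
  rw [h2, h2]
  exact ((hf.contDiffAt (hU.mem_nhds hp)).isSymmSndFDerivAt
    (by rw [minSmoothness_of_isRCLikeNormedField]; exact WithTop.coe_le_coe.2 (le_top : (2 : ℕ∞) ≤ ⊤))).eq _ _

/-- The projection `(η, u, v, x, y) ↦ (u, x, y)` as a continuous linear map. -/
def uxyL : (Fin 5 → ℝ) →L[ℝ] (Fin 3 → ℝ) :=
  ContinuousLinearMap.pi ![.proj 1, .proj 3, .proj 4]

theorem uxyL_apply (p : Fin 5 → ℝ) : uxyL p = uxy p := by
  ext i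
  fin_cases i <;> simp [uxyL, uxy]

theorem isOpen_uxy_preimage {W : Set (Fin 3 → ℝ)} (hW : IsOpen W) :
    IsOpen {p : Fin 5 → ℝ | uxy p ∈ W} := by
  simpa only [Set.preimage, uxyL_apply] using hW.preimage uxyL.continuous

theorem hasFDerivAt_comp_uxy {f : (Fin 3 → ℝ) → ℝ} {p : Fin 5 → ℝ}
    (hf : DifferentiableAt ℝ f (uxy p)) :
    HasFDerivAt (fun q => f (uxy q)) ((fderiv ℝ f (uxy p)).comp uxyL) p := by
  rw [← uxyL_apply] at hf ⊢
  simpa only [Function.comp_def, uxyL_apply] using hf.hasFDerivAt.comp p uxyL.hasFDerivAt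

theorem single_apply_eq_dX (d i : Fin 5) : (Pi.single d 1 : Fin 5 → ℝ) i = dX i d := by
  simp [Pi.single_apply, dX, eq_comm]

theorem fderiv_comp_uxyL_single (f : (Fin 3 → ℝ) → ℝ) (p : Fin 5 → ℝ) (d : Fin 5) :
    ((fderiv ℝ f (uxy p)).comp uxyL) (Pi.single d 1)
      = diffUXY (pd 0 f (uxy p)) (pd 1 f (uxy p)) (pd 2 f (uxy p)) d := by
  rw [ContinuousLinearMap.comp_apply, fderiv_apply_eq_sum_pd, uxyL_apply, Fin.sum_univ_three]
  simp only [uxy, single_apply_eq_dX, diffUXY, Matrix.cons_val]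
  ring

theorem hasFDerivAt_inv_x {p : Fin 5 → ℝ} (hp : p 3 ≠ 0) :
    HasFDerivAt (fun q : Fin 5 → ℝ => (q 3)⁻¹)
      (-(p 3 ^ 2)⁻¹ • (ContinuousLinearMap.proj 3 : (Fin 5 → ℝ) →L[ℝ] ℝ)) p :=
  (hasDerivAt_inv hp).comp_hasFDerivAt p
    (ContinuousLinearMap.proj 3 : (Fin 5 → ℝ) →L[ℝ] ℝ).hasFDerivAt

theorem pd_prodMetric {l : ℝ} {H : (Fin 3 → ℝ) → ℝ} {p : Fin 5 → ℝ} (hp : p 3 ≠ 0)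
    (hH : DifferentiableAt ℝ H (uxy p)) (d a b : Fin 5) :
    pd d (fun q => siklosMetric l H q a b) p
      = prodMetricDeriv (p 3)⁻¹ (l ^ 2 / p 3 ^ 2) (H (uxy p)) (pd 0 H (uxy p)) (pd 1 H (uxy p))
          (pd 2 H (uxy p)) d a b := by
  have hr := hasFDerivAt_inv_x hp
  have hh := hasFDerivAt_comp_uxy hH
  have h := (((hr.mul hr).const_mul (l ^ 2)).mul
    ((hh.mul_const (dX 1 a * dX 1 b)).add_const (waveMetric 0 a b))).const_add (dX 0 a * dX 0 b)
  have hf : (fun q => siklosMetric l H q a b) = fun q : Fin 5 → ℝ => dX 0 a * dX 0 b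
      + l ^ 2 * ((q 3)⁻¹ * (q 3)⁻¹) * (H (uxy q) * (dX 1 a * dX 1 b) + waveMetric 0 a b) := by
    ext q
    simp only [siklosMetric_eq, prodMetric, waveMetric, div_eq_mul_inv]
    ring
  rw [pd, hf]
  erw [h.fderiv]
  simp only [add_apply, smul_apply, smul_eq_mul,
    fderiv_comp_uxyL_single, ContinuousLinearMap.proj_apply, single_apply_eq_dX, prodMetricDeriv,
    waveMetric, div_eq_mul_inv, Pi.mul_apply]
  ring

theorem pd_siklosChristoffel {H : (Fin 3 → ℝ) → ℝ} {W : Set (Fin 3 → ℝ)} (hW : IsOpen W)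
    (hH : ContDiffOn ℝ ∞ H W) {p : Fin 5 → ℝ} (hpW : uxy p ∈ W) (hp : p 3 ≠ 0)
    (a b c d : Fin 5) :
    pd d (fun q => siklosChristoffel (q 3)⁻¹ (H (uxy q)) (pd 0 H (uxy q)) (pd 1 H (uxy q))
        (pd 2 H (uxy q)) a b c) p
      = siklosChristoffelDeriv (p 3)⁻¹ (H (uxy p)) (pd 0 H (uxy p)) (pd 1 H (uxy p))
          (pd 2 H (uxy p)) (pd 0 (pd 0 H) (uxy p)) (pd 1 (pd 0 H) (uxy p)) (pd 2 (pd 0 H) (uxy p))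
          (pd 1 (pd 1 H) (uxy p)) (pd 2 (pd 1 H) (uxy p)) (pd 2 (pd 2 H) (uxy p)) a b c d := by
  have hdiff : ∀ f : (Fin 3 → ℝ) → ℝ, ContDiffOn ℝ ∞ f W → DifferentiableAt ℝ f (uxy p) :=
    fun f hf => (hf.contDiffAt (hW.mem_nhds hpW)).differentiableAt (by simp)
  have hr := hasFDerivAt_inv_x hp
  have hh := hasFDerivAt_comp_uxy (hdiff H hH)
  have hi := fun i => hasFDerivAt_comp_uxy (hdiff _ (contDiffOn_pd hW hH i))
  -- `c1`, …, `c5` stand for the constant coefficients of `r`, `r H`, `H_u`, `H_x`, `H_y` in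
  -- `siklosChristoffel`.
  have h := fun c1 c2 c3 c4 c5 : ℝ => (((((hr.const_mul c1).add ((hr.mul hh).const_mul c2)).add
    ((hi 0).const_mul c3)).add ((hi 1).const_mul c4)).add ((hi 2).const_mul c5)).fderiv
  rw [pd]
  unfold siklosChristoffel
  erw [h]
  simp only [add_apply, smul_apply, smul_eq_mul,
    fderiv_comp_uxyL_single, ContinuousLinearMap.proj_apply, single_apply_eq_dX,
    siklosChristoffelDeriv]
  rw [pd_comm hW hH hpW 0 1, pd_comm hW hH hpW 0 2, pd_comm hW hH hpW 1 2]
  ring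

/-! ### Curvature of the metric itself -/

section

variable {l : ℝ} {H : (Fin 3 → ℝ) → ℝ} {W : Set (Fin 3 → ℝ)}

theorem siklosMetric_inv (hl : l ≠ 0) {p : Fin 5 → ℝ} (hp : p 3 ≠ 0) :
    (siklosMetric l H p)⁻¹ = prodMetricInv (p 3 ^ 2 / l ^ 2) (H (uxy p)) := by
  rw [siklosMetric_eq]
  exact prodMetric_inv (by field_simp) _

theorem siklosMetric_isMetricOn (hl : l ≠ 0) (hx : ∀ q ∈ W, q 1 ≠ 0) (hH : ContDiffOn ℝ ∞ H W) :
    IsMetricOn (siklosMetric l H) {p | uxy p ∈ W} where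
  smooth a b := by
    have hu : ContDiffOn ℝ ∞ (fun p => H (uxy p)) {p | uxy p ∈ W} := by
      simp only [← uxyL_apply]
      exact hH.comp uxyL.contDiff.contDiffOn fun p hp => hp
    have hs : ContDiffOn ℝ ∞ (fun p : Fin 5 → ℝ => l ^ 2 / p 3 ^ 2) {p | uxy p ∈ W} :=
      contDiffOn_const.div (by fun_prop) fun p hp => pow_ne_zero 2 (hx _ hp)
    simp only [siklosMetric_eq, prodMetric, waveMetric]
    exact contDiffOn_const.add (hs.mul ((((hu.mul contDiffOn_const).add contDiffOn_const).add
      contDiffOn_const).add contDiffOn_const))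
  symm p _ := by
    rw [siklosMetric_eq]
    ext a b
    simp only [Matrix.transpose_apply, prodMetric, waveMetric]
    ring
  nondegenerate p hp := by
    have h3 : p 3 ≠ 0 := hx _ hp
    rw [siklosMetric_eq]
    exact Matrix.det_ne_zero_of_right_inverse
      (prodMetric_mul_inv (t := p 3 ^ 2 / l ^ 2) (by field_simp) _)

theorem christoffel_siklosMetric (hl : l ≠ 0) {p : Fin 5 → ℝ} (hp : p 3 ≠ 0)
    (hH : DifferentiableAt ℝ H (uxy p)) (a b c : Fin 5) :
    christoffel (siklosMetric l H) a b c p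
      = siklosChristoffel (p 3)⁻¹ (H (uxy p)) (pd 0 H (uxy p)) (pd 1 H (uxy p)) (pd 2 H (uxy p))
          a b c := by
  rw [← sum_prodMetricDeriv (s := l ^ 2 / p 3 ^ 2) (t := p 3 ^ 2 / l ^ 2) (by field_simp)]
  simp only [christoffel, siklosMetric_inv hl hp, pd_prodMetric hp hH]

/-- Only the trace `β + δ` is recorded, because `C · R` depends on `A` through it alone. -/
theorem riemann_siklosMetric (hl : l ≠ 0) (hW : IsOpen W) (hx : ∀ q ∈ W, q 1 ≠ 0)
    (hH : ContDiffOn ℝ ∞ H W) {p : Fin 5 → ℝ} (hp : uxy p ∈ W) :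
    ∃ β γ δ : ℝ, (p 3 ^ 2 / l ^ 2) * (β + δ) = -(siklosPhi H (uxy p) / (2 * p 3)) ∧
      riemann (siklosMetric l H) p
        = siklosCurvature (p 3)⁻¹ (l ^ 2 / p 3 ^ 2) (H (uxy p)) β γ δ := by
  have h3 : p 3 ≠ 0 := hx _ hp
  -- The formula is needed on the whole open set, since it is then differentiated.
  have hc : ∀ a b c, ∀ q ∈ {q : Fin 5 → ℝ | uxy q ∈ W}, christoffel (siklosMetric l H) a b c q
      = siklosChristoffel (q 3)⁻¹ (H (uxy q)) (pd 0 H (uxy q)) (pd 1 H (uxy q)) (pd 2 H (uxy q))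
          a b c := fun a b c q hq =>
    christoffel_siklosMetric hl (hx _ hq)
      ((hH.contDiffAt (hW.mem_nhds hq)).differentiableAt (by simp)) a b c
  have hd : ∀ a b c d, pd d (christoffel (siklosMetric l H) a b c) p = _ := fun a b c d =>
    (pd_congr (isOpen_uxy_preimage hW) (hc a b c) hp d).trans
      (pd_siklosChristoffel hW hH hp h3 a b c d)
  set s := l ^ 2 / p 3 ^ 2 with hs
  set r := (p 3)⁻¹ with hr
  refine ⟨-(s / 2) * (pd 1 (pd 1 H) (uxy p) - r * pd 1 H (uxy p)),
    -(s / 2) * pd 2 (pd 1 H) (uxy p),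
    -(s / 2) * (pd 2 (pd 2 H) (uxy p) - r * pd 1 H (uxy p)), ?_, ?hR⟩
  case hR =>
    ext a b c d
    simp only [riemann, hd, hc _ _ _ p hp]
    rw [siklosMetric_eq]
    exact sum_siklosChristoffelDeriv _ _ _ _ _ _ _ _ _ _ _ _ _ _ _ _
  · have hq : uxy p 1 = p 3 := rfl
    rw [siklosPhi, hq, hs, hr]
    field_simp
    ring

theorem weyl_siklosMetric (hl : l ≠ 0) {p : Fin 5 → ℝ} (hp : p 3 ≠ 0) {β γ δ : ℝ}
    (hR : riemann (siklosMetric l H) p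
      = siklosCurvature (p 3)⁻¹ (l ^ 2 / p 3 ^ 2) (H (uxy p)) β γ δ) :
    weyl (siklosMetric l H) p = kulkarniNomizu nullSq
      (transverse (-(p 3 ^ 2 / l ^ 2 * (β + δ)) / 3) ((2 * β - δ) / 3) γ ((2 * δ - β) / 3)) := by
  have hst : l ^ 2 / p 3 ^ 2 * (p 3 ^ 2 / l ^ 2) = 1 := by field_simp
  have hS : ricci (siklosMetric l H) p = fun a b => -3 * (p 3)⁻¹ ^ 2 * waveMetric (H (uxy p)) a b
      + p 3 ^ 2 / l ^ 2 * (β + δ) * nullSq a b := by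
    ext a b
    simp only [ricci, siklosMetric_inv hl hp, hR]
    exact ricci_siklosCurvature hst _ _ _ _ _ _ _
  have hκ : scalarCurvature (siklosMetric l H) p = -12 * (p 3)⁻¹ ^ 2 * (p 3 ^ 2 / l ^ 2) := by
    simp only [scalarCurvature, siklosMetric_inv hl hp, hS]
    exact scalar_siklosCurvature _ _ _ _
  ext a b c d
  rw [← weyl_siklosCurvature hst (p 3)⁻¹ (H (uxy p))]
  simp only [weyl, hR, hκ, hS, siklosMetric_eq]
  -- For `n = 5` the constants `2 (n - 1) (n - 2)` and `n - 2` are `24` and `3`.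
  norm_num

end

/-! ### The tensors `C · C` and `C · R` -/

theorem dot_weyl_weyl_siklosMetric {l : ℝ} {H : (Fin 3 → ℝ) → ℝ} {W : Set (Fin 3 → ℝ)}
    (hl : l ≠ 0) (hW : IsOpen W) (hx : ∀ q ∈ W, q 1 ≠ 0)
    (hH : ContDiffOn ℝ ∞ H W) {p : Fin 5 → ℝ} (hp : uxy p ∈ W) :
    dot (siklosMetric l H) p (weyl (siklosMetric l H) p) (weyl (siklosMetric l H) p) = 0 := by
  have h3 : p 3 ≠ 0 := hx _ hp
  obtain ⟨β, γ, δ, -, hR⟩ := riemann_siklosMetric hl hW hx hH hp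
  ext i j k m a b
  simp only [dot, weyl_siklosMetric hl h3 hR, siklosMetric_inv hl h3,
    kulkarniNomizu_nullSq_eq_nullRotation _ _ _ _ a b, nullRotation_sum_nullSq, Pi.zero_apply]

theorem dot_weyl_riemann_siklosMetric {l : ℝ} {H : (Fin 3 → ℝ) → ℝ} {W : Set (Fin 3 → ℝ)}
    (hl : l ≠ 0) (hW : IsOpen W) (hx : ∀ q ∈ W, q 1 ≠ 0)
    (hH : ContDiffOn ℝ ∞ H W) {p : Fin 5 → ℝ} (hp : uxy p ∈ W) :
    dot (siklosMetric l H) p (weyl (siklosMetric l H) p) (riemann (siklosMetric l H) p)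
      = fun i j k m a b => siklosPhi H (uxy p) / (6 * p 3 ^ 3)
          * kulkarniNomizu (waveMetric 0) crossSq i j k m
          * (dX 1 a * dX 0 b - dX 0 a * dX 1 b) := by
  have h3 : p 3 ≠ 0 := hx _ hp
  obtain ⟨β, γ, δ, hφ, hR⟩ := riemann_siklosMetric hl hW hx hH hp
  ext i j k m a b
  simp only [dot, weyl_siklosMetric hl h3 hR, siklosMetric_inv hl h3,
    kulkarniNomizu_nullSq_eq_nullRotation _ _ _ _ a b]
  -- By `hφ` the coefficient `-t (β + δ)/3` of `dη²` in `Q` equals `φ/(6x)`.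
  rw [hR, nullRotation_sum_siklosCurvature, hφ]
  field_simp
  ring

theorem sym2_eq_of_dX_ne_zero {a b : Fin 5} (h : dX 1 a * dX 0 b - dX 0 a * dX 1 b ≠ 0) :
    s(a, b) = s(0, 1) := by
  by_cases h0 : a = 1 ∧ b = 0
  · rw [h0.1, h0.2, Sym2.eq_swap]
  by_cases h1 : a = 0 ∧ b = 1
  · rw [h1.1, h1.2]
  exact absurd (by unfold dX; grind) h

end CoordGeometry

end
/-- Indices `0, 1, 2, 3, 4` stand for the coordinates `η, u, v, x, y`, and `W` is the open set of
triples `(u, x, y)` on which the smooth function `H` is given. -/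
theorem mainTheorem3 (l : ℝ) (hl : l ≠ 0) (W : Set (Fin 3 → ℝ)) (hW : IsOpen W)
    (hx : ∀ q ∈ W, q 1 ≠ 0) (H : (Fin 3 → ℝ) → ℝ) (hH : ContDiffOn ℝ ∞ H W) :
    let g := CoordGeometry.siklosMetric l H
    let M : Set (Fin 5 → ℝ) := {p | CoordGeometry.uxy p ∈ W}
    CoordGeometry.IsMetricOn g M ∧
    ∀ p ∈ M,
      let C := CoordGeometry.weyl g p
      let R := CoordGeometry.riemann g p
      let B := CoordGeometry.dot g p C R
      let φ := CoordGeometry.siklosPhi H (CoordGeometry.uxy p)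
      -- semisymmetric Weyl tensor
      CoordGeometry.dot g p C C = 0 ∧
      -- the nonzero components of `C · R`
      B 0 1 1 2 0 1 = φ / (6 * p 3 ^ 3) ∧
      B 0 3 1 3 0 1 = φ / (6 * p 3 ^ 3) ∧
      B 0 4 1 4 0 1 = φ / (6 * p 3 ^ 3) ∧
      -- the symmetries of `C · R`
      (∀ a b c d e f, B b a c d e f = -B a b c d e f ∧ B a b d c e f = -B a b c d e f ∧
        B c d a b e f = B a b c d e f ∧ B a b c d f e = -B a b c d e f) ∧
      -- up to these symmetries there are no other nonzero components
      (∀ a b c d e f, B a b c d e f ≠ 0 →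
        s(e, f) = s(0, 1) ∧
          (s(s(a, b), s(c, d)) = s(s(0, 1), s(1, 2)) ∨
            s(s(a, b), s(c, d)) = s(s(0, 3), s(1, 3)) ∨
            s(s(a, b), s(c, d)) = s(s(0, 4), s(1, 4)))) ∧
      -- where `C · R` does not vanish
      (B ≠ 0 ↔ φ ≠ 0) := by
  intro g M
  refine ⟨CoordGeometry.siklosMetric_isMetricOn hl hx hH, fun p hp => ?_⟩
  intro C R B φ
  have hp3 : p 3 ≠ 0 := hx _ hp
  have hB : B = fun a b c d e f => φ / (6 * p 3 ^ 3)
      * CoordGeometry.kulkarniNomizu (CoordGeometry.waveMetric 0) CoordGeometry.crossSq a b c d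
      * (CoordGeometry.dX 1 e * CoordGeometry.dX 0 f
        - CoordGeometry.dX 0 e * CoordGeometry.dX 1 f) :=
    CoordGeometry.dot_weyl_riemann_siklosMetric hl hW hx hH hp
  have hB1 : B 0 1 1 2 0 1 = φ / (6 * p 3 ^ 3) := by
    simp [hB, CoordGeometry.kulkarniNomizu, CoordGeometry.waveMetric, CoordGeometry.crossSq]
  refine ⟨CoordGeometry.dot_weyl_weyl_siklosMetric hl hW hx hH hp, hB1, ?_, ?_, ?_, ?_, ?_⟩
  · simp [hB, CoordGeometry.kulkarniNomizu, CoordGeometry.waveMetric, CoordGeometry.crossSq]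
  · simp [hB, CoordGeometry.kulkarniNomizu, CoordGeometry.waveMetric, CoordGeometry.crossSq]
  · intro a b c d e f
    simp only [hB, CoordGeometry.kulkarniNomizu, CoordGeometry.waveMetric, CoordGeometry.crossSq]
    refine ⟨?_, ?_, ?_, ?_⟩ <;> ring
  · intro a b c d e f h
    simp only [hB] at h
    exact ⟨CoordGeometry.sym2_eq_of_dX_ne_zero (right_ne_zero_of_mul h),
      CoordGeometry.kulkarniNomizu_waveMetric_crossSq_support a b c d
        (right_ne_zero_of_mul (left_ne_zero_of_mul h))⟩
  · refine ⟨fun h hφ => h ?_, fun hφ h => ?_⟩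
    · rw [hB, hφ]
      ext
      simp
    · rw [h] at hB1
      exact div_ne_zero hφ (mul_ne_zero (by norm_num) (pow_ne_zero 3 hp3)) hB1.symm
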